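/- There is an absolute constant $c$ such that every simple undirected graph $G$ (finite or infinite) that contains no triangle and no induced cycle of even length at least $6$ satisfies $\chi(G) < c$, where $\chi(G)$ denotes the chromatic number of $G$, i.e. the smallest number of colors in a coloring of the vertices in which any two adjacent vertices receive different colors. (Induced cycles of length $4$ are allowed.) -/

import Mathlib

/-! The proof is in two steps: balls of bounded radius have bounded chromatic number, and then a
large chromatic number would force vertices that are far apart but joined by three mutually
non-interfering paths.

Local step. Suppose a stable set `F` is attached to a connected set `X`, with `X ∪ F` bipartite and
`F` on one side. If `A` is covered by `F` and sees nothing of `X`, then `A` is bipartite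
(`colorable_two_of_cover`): an odd hole in `A` would have an even arc which two vertices of `F` and
an even path through `X` close into a long even hole. Applied level by level around a vertex, this
splits each colour class into two, so a ball of radius `r` needs at most `2 ^ r` colours
(`edist_le_colorable`).

Global step. If the chromatic number is large, passing to a distance level, four times over, gives
four nested systems, each with its own connected set `X`. Every vertex of the innermost set is the
site of a tripod, with three separate links to three of these sets. Two tripods on the same triple
at distance more than 6 would yield three paths with common ends, two of them of equal parity, hence
a long even hole (`IsTripod.edist_le`). So the tripods on one triple lie in a ball of radius 6 and
take 64 colours; three triples suffice. -/

namespace SimpleGraph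

variable {V : Type*} {G : SimpleGraph V}

/-! ### Induced cycles and induced paths -/

/-- A graph with vertices `c 0, …, c (n - 1)` in cyclic order contains an induced `n`-cycle. -/
theorem cycleGraph_isIndContained_of_nat {n : ℕ} (c : ℕ → V)
    (h : ∀ i j, i < j → j < n →
      c i ≠ c j ∧ (G.Adj (c i) (c j) ↔ j = i + 1 ∨ (i = 0 ∧ j + 1 = n))) :
    (cycleGraph n).IsIndContained G := by
  have key : ∀ a b : Fin n, a < b →
      ((cycleGraph n).Adj a b ↔ (b : ℕ) = a + 1 ∨ ((a : ℕ) = 0 ∧ (b : ℕ) + 1 = n)) := by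
    intro a b hab
    have hab' : (a : ℕ) < b := hab
    rw [cycleGraph_adj', Fin.sub_val_of_le hab.le, Fin.coe_sub_iff_lt.mpr hab]
    omega
  refine ⟨⟨⟨fun i => c i, ?_⟩, ?_⟩⟩
  · intro a b hab
    rcases lt_trichotomy a b with hlt | heq | hlt
    · exact absurd hab (h a b hlt b.2).1
    · exact heq
    · exact absurd hab.symm (h b a hlt a.2).1
  · intro a b
    change G.Adj (c a) (c b) ↔ _
    rcases lt_trichotomy a b with hlt | heq | hlt
    · rw [(h a b hlt b.2).2, key a b hlt]
    · subst heq; simp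
    · rw [G.adj_comm, (h b a hlt a.2).2, adj_comm, key b a hlt]

/-- `p 0, …, p n` are the vertices of an induced path, in order. -/
def IsInducedPath (G : SimpleGraph V) (p : ℕ → V) (n : ℕ) : Prop :=
  ∀ i j, i < j → j ≤ n → p i ≠ p j ∧ (G.Adj (p i) (p j) ↔ j = i + 1)

/-- Follow `p` forwards and return along `q`. This is how every long even hole other than a hexagon
is produced below. -/
theorem cycleGraph_isIndContained_of_paths {p q : ℕ → V} {a b : ℕ}
    (hp : G.IsInducedPath p a) (hq : G.IsInducedPath q b) (h0 : p 0 = q 0) (h1 : p a = q b)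
    (ha : 2 ≤ a) (hb : 2 ≤ b)
    (hpq : ∀ i j, 0 < i → i < a → 0 < j → j < b → p i ≠ q j ∧ ¬ G.Adj (p i) (q j)) :
    (cycleGraph (a + b)).IsIndContained G := by
  refine cycleGraph_isIndContained_of_nat (fun k => if k ≤ a then p k else q (a + b - k)) ?_
  intro i j hij hj
  by_cases hja : j ≤ a
  · have hia : i ≤ a := by omega
    simp only [hia, hja, if_true]
    refine ⟨(hp i j hij hja).1, ?_⟩
    rw [(hp i j hij hja).2]
    omega
  · by_cases hia : i ≤ a
    · simp only [hia, hja, if_true, if_false]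
      rcases Nat.eq_zero_or_pos i with rfl | hi0
      · rw [h0]
        have := hq 0 (a + b - j) (by omega) (by omega)
        refine ⟨this.1, ?_⟩
        rw [this.2]
        omega
      · rcases Nat.lt_or_ge i a with hia' | hia'
        · have := hpq i (a + b - j) hi0 hia' (by omega) (by omega)
          refine ⟨this.1, iff_of_false this.2 (by omega)⟩
        · obtain rfl : i = a := by omega
          rw [h1]
          have := hq (i + b - j) b (by omega) le_rfl
          refine ⟨this.1.symm, ?_⟩
          rw [G.adj_comm, this.2]
          omega
    · simp only [hia, hja, if_false]
      have := hq (a + b - j) (a + b - i) (by omega) (by omega)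
      refine ⟨this.1.symm, ?_⟩
      rw [G.adj_comm, this.2]
      omega

/-- The edges of `G` with both ends in `S`, as a graph on all vertices. -/
def within (G : SimpleGraph V) (S : Set V) : SimpleGraph V where
  Adj u w := u ∈ S ∧ w ∈ S ∧ G.Adj u w
  symm := ⟨fun _ _ h => ⟨h.2.1, h.1, h.2.2.symm⟩⟩
  loopless := ⟨fun _ h => G.loopless.irrefl _ h.2.2⟩

theorem within_mono {S T : Set V} (h : S ⊆ T) : G.within S ≤ G.within T :=
  fun _ _ hab => ⟨h hab.1, h hab.2.1, hab.2.2⟩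

theorem within_le {S : Set V} : G.within S ≤ G := fun _ _ hab => hab.2.2

theorem mem_of_within_walk {S : Set V} {x y : V} (w : (G.within S).Walk x y) (hx : x ∈ S) :
    y ∈ S := by
  induction w with
  | nil => exact hx
  | cons h _ ih => exact ih h.2.1

/-- A shortest path inside `T` has no chord: a chord would also lie in `T` and shorten it. -/
theorem exists_isInducedPath {T : Set V} {x y : V} (h : (G.within T).Reachable x y) (hx : x ∈ T) :
    ∃ (n : ℕ) (p : ℕ → V), p 0 = x ∧ p n = y ∧ (∀ i, p i ∈ T) ∧ G.IsInducedPath p n := by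
  obtain ⟨w, hw⟩ := h.exists_walk_length_eq_dist
  have hT : ∀ i, w.getVert i ∈ T := fun i => mem_of_within_walk (w.take i) hx
  refine ⟨w.length, w.getVert, by simp, by simp, hT, ?_⟩
  have hd : ∀ i j, i < j → j ≤ w.length →
      j ≤ i + (G.within T).dist (w.getVert i) (w.getVert j) := by
    intro i j hij hj
    have hr : (G.within T).Reachable x (w.getVert i) := ⟨w.take i⟩
    have hr' : (G.within T).Reachable x (w.getVert j) := ⟨w.take j⟩
    have h1 := dist_le (w.take i)
    have h2 := dist_le (w.drop j)
    have h3 := hr.dist_triangle_left y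
    have h4 := (hr.symm.trans hr').dist_triangle_left y
    rw [Walk.take_length] at h1
    rw [Walk.drop_length] at h2
    omega
  intro i j hij hj
  have := hd i j hij hj
  refine ⟨fun he => ?_, fun hadj => ?_, ?_⟩
  · rw [he, dist_self] at this
    omega
  · have h1 : (G.within T).Adj (w.getVert i) (w.getVert j) := ⟨hT i, hT j, hadj⟩
    rw [dist_eq_one_iff_adj.mpr h1] at this
    omega
  · rintro rfl
    exact (w.adj_getVert_succ (by omega)).2.2

/-! ### Excluded holes and shortest odd cycles -/

/-- `G` has no induced cycle of even length at least `6`. -/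
def NoLongEvenHole (G : SimpleGraph V) : Prop :=
  ∀ n : ℕ, 6 ≤ n → Even n → ¬ (cycleGraph n).IsIndContained G

theorem CliqueFree.not_adj_of_common {a b c : V} (h : G.CliqueFree 3) (hab : G.Adj a b)
    (hbc : G.Adj b c) : ¬ G.Adj a c := by
  classical
  exact fun hac => h {a, b, c} (is3Clique_triple_iff.mpr ⟨hab, hac, hbc⟩)

theorem NoLongEvenHole.not_hexagon (h : G.NoLongEvenHole) {a b c d e f : V}
    (hab : G.Adj a b) (hbc : G.Adj b c) (hcd : G.Adj c d) (hde : G.Adj d e) (hef : G.Adj e f)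
    (hfa : G.Adj f a) (hac : ¬ G.Adj a c) (had : ¬ G.Adj a d) (hae : ¬ G.Adj a e)
    (hbd : ¬ G.Adj b d) (hbe : ¬ G.Adj b e) (hbf : ¬ G.Adj b f) (hce : ¬ G.Adj c e)
    (hcf : ¬ G.Adj c f) (hdf : ¬ G.Adj d f) : False := by
  -- Two vertices are told apart by a neighbour of one that is not a neighbour of the other.
  have ne : ∀ {x y z : V}, G.Adj x z → ¬ G.Adj y z → x ≠ y := by
    rintro x y z h1 h2 rfl; exact h2 h1
  let s : ℕ → V := fun k => if k = 0 then a else if k = 1 then b else if k = 2 then c else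
    if k = 3 then d else if k = 4 then e else f
  refine h 6 le_rfl (by decide) (cycleGraph_isIndContained_of_nat s ?_)
  intro i j hij hj
  interval_cases j <;> interval_cases i <;> simp only [s] <;> norm_num
  · exact ⟨hab.ne, hab⟩
  · exact ⟨ne hfa.symm hcf, hac⟩
  · exact ⟨hbc.ne, hbc⟩
  · exact ⟨ne hfa.symm hdf, had⟩
  · exact ⟨ne hab.symm (fun h => had h.symm), hbd⟩
  · exact ⟨hcd.ne, hcd⟩
  · exact ⟨ne hab (fun h => hbe h.symm), hae⟩
  · exact ⟨ne hab.symm (fun h => hae h.symm), hbe⟩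
  · exact ⟨ne hbc.symm (fun h => hbe h.symm), hce⟩
  · exact ⟨hde.ne, hde⟩
  · exact ⟨hfa.ne', hfa.symm⟩
  · exact ⟨ne hbc (fun h => hcf h.symm), hbf⟩
  · exact ⟨ne hbc.symm (fun h => hbf h.symm), hcf⟩
  · exact ⟨ne hcd.symm (fun h => hcf h.symm), hdf⟩
  · exact ⟨hef.ne, hef⟩

/-- A triangle-free graph that is not bipartite has an induced odd cycle, here written as a
periodic sequence of vertices. -/
theorem exists_odd_hole {A : Set V} (hG : G.CliqueFree 3) (hA : ¬ (G.within A).Colorable 2) :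
    ∃ (m : ℕ) (c : ℕ → V), Odd m ∧ 5 ≤ m ∧ (∀ i, c i ∈ A) ∧ (∀ i, c (i + m) = c i) ∧
      (∀ i, G.Adj (c i) (c (i + 1))) ∧ (∀ i j, i < j → j < i + m → c i ≠ c j) ∧
      (∀ i j, i + 1 < j → j + 1 < i + m → ¬ G.Adj (c i) (c j)) := by
  classical
  let P : ℕ → Prop := fun m => Odd m ∧ ∃ c : ℕ → V, (∀ i, c i ∈ A) ∧ (∀ i, c (i + m) = c i) ∧
    ∀ i, G.Adj (c i) (c (i + 1))
  have cut : ∀ (c : ℕ → V) (i d : ℕ), Odd d → (∀ k < d, c (i + k) ∈ A) →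
      (∀ k, k + 1 < d → G.Adj (c (i + k)) (c (i + k + 1))) →
      G.Adj (c (i + (d - 1))) (c i) → P d := by
    intro c i d hd hcA hadj hclose
    have hd0 : 0 < d := hd.pos
    refine ⟨hd, fun k => c (i + k % d), fun k => hcA _ (Nat.mod_lt _ hd0),
      fun k => by simp, fun k => ?_⟩
    have hk := Nat.mod_lt k hd0
    have hstep : (k + 1) % d = if k % d + 1 = d then 0 else k % d + 1 := by
      rw [Nat.add_mod]
      rcases Nat.lt_or_ge 1 d with h1 | h1
      · rw [Nat.mod_eq_of_lt h1]
        split_ifs with h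
        · rw [h, Nat.mod_self]
        · exact Nat.mod_eq_of_lt (by omega)
      · obtain rfl : d = 1 := by omega
        simp [Nat.mod_one]
    show G.Adj (c (i + k % d)) (c (i + (k + 1) % d))
    rw [hstep]
    split_ifs with h
    · rw [show k % d = d - 1 by omega]
      exact hclose
    · exact hadj _ (by omega)
  have hex : ∃ m, P m := by
    rw [two_colorable_iff_forall_loop_even] at hA
    push Not at hA
    obtain ⟨u, w, hw⟩ := hA
    have hodd := Nat.not_even_iff_odd.mp hw
    have hpos := hodd.pos
    have huA : u ∈ A := by
      have := (w.adj_getVert_succ hpos).1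
      simpa using this
    refine ⟨w.length, cut w.getVert 0 _ hodd (fun k _ => mem_of_within_walk (w.take _) huA)
      (fun k hk => (w.adj_getVert_succ (by omega)).2.2) ?_⟩
    have := (w.adj_getVert_succ (i := w.length - 1) (by omega)).2.2
    rw [show w.length - 1 + 1 = w.length by omega] at this
    simpa using this
  obtain ⟨hmo, c, hcA, hper, hadj⟩ := Nat.find_spec hex
  have hmin : ∀ d, d < Nat.find hex → ¬ P d := fun d hd => Nat.find_min hex hd
  set m := Nat.find hex
  have cut' : ∀ i d, Odd d → d < m → ¬ G.Adj (c (i + (d - 1))) (c i) := fun i d hd hdm h =>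
    hmin d hdm (cut c i d hd (fun _ _ => hcA _) (fun _ _ => hadj _) h)
  -- A chord splits an odd cycle into two shorter closed walks, one of them odd, against the
  -- minimality of `m`. A repeated vertex does the same in `hinj`.
  have hchord : ∀ i j, i + 1 < j → j + 1 < i + m → ¬ G.Adj (c i) (c j) := by
    intro i j h1 h2 h
    rcases Nat.even_or_odd (j - i) with he | ho
    · refine cut' i (j - i + 1) he.add_one (by omega) ?_
      rw [show i + (j - i + 1 - 1) = j by omega]
      exact h.symm
    · refine cut' j (i + m - j + 1) ?_ (by omega) ?_
      · have : i + m - j + 1 + (j - i) = m + 1 := by omega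
        rw [Nat.odd_iff] at *
        omega
      · rw [show j + (i + m - j + 1 - 1) = i + m by omega, hper]
        exact h
  have hinj : ∀ i j, i < j → j < i + m → c i ≠ c j := by
    intro i j h1 h2 h
    rcases Nat.even_or_odd (j - i) with he | ho
    · refine cut' j (i + m - j) ?_ (by omega) ?_
      · rw [Nat.odd_iff] at *
        rw [Nat.even_iff] at he
        omega
      · have := hadj (j + (i + m - j - 1))
        rw [show j + (i + m - j - 1) + 1 = i + m by omega, hper, h] at this
        exact this
    · refine cut' i (j - i) ho (by omega) ?_
      have := hadj (i + (j - i - 1))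
      rw [show i + (j - i - 1) + 1 = j by omega, ← h] at this
      exact this
  refine ⟨m, c, hmo, ?_, hcA, hper, hadj, hinj, hchord⟩
  by_contra hlt
  have : m = 1 ∨ m = 3 := by
    rw [Nat.odd_iff] at hmo
    omega
  rcases this with h | h
  · have h1 := hadj 0
    have h2 := hper 0
    rw [h] at h2
    rw [h2] at h1
    exact G.loopless.irrefl _ h1
  · have h2 := hper 0
    rw [h] at h2
    have h3 := hadj 2
    rw [h2] at h3
    exact hG.not_adj_of_common (hadj 0) (hadj 1) h3.symm

/-! ### Sets covered by an attached stable set are bipartite -/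

theorem exists_isInducedPath_interior {S : Set V} {x y : V}
    (h : (G.within (S ∪ {x, y})).Reachable x y) :
    ∃ (n : ℕ) (p : ℕ → V), p 0 = x ∧ p n = y ∧ G.IsInducedPath p n ∧
      ∀ i, 0 < i → i < n → p i ∈ S := by
  obtain ⟨n, p, h0, hn, hT, hp⟩ := exists_isInducedPath h (by simp)
  refine ⟨n, p, h0, hn, hp, fun i hi hin => ?_⟩
  rcases hT i with h | h | h
  · exact h
  · exact absurd (h0.trans h.symm) (hp 0 i hi hin.le).1
  · exact absurd (h.trans hn.symm) (hp i n hin le_rfl).1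

theorem reachable_within_of_adj {X : Set V} {x y a b : V}
    (hX : ∀ a ∈ X, ∀ b ∈ X, (G.within X).Reachable a b) (ha : a ∈ X) (hb : b ∈ X)
    (hxa : G.Adj x a) (hyb : G.Adj y b) : (G.within (X ∪ {x, y})).Reachable x y := by
  have h1 : (G.within (X ∪ {x, y})).Adj x a := ⟨by simp, by simp [ha], hxa⟩
  have h2 : (G.within (X ∪ {x, y})).Adj b y := ⟨by simp [hb], by simp, hyb.symm⟩
  exact (h1.reachable.trans ((hX a ha b hb).mono (within_mono Set.subset_union_left))).trans h2.reachable

/-- Induced paths through `X` between two vertices of `F` are even when `X ∪ F` is bipartite with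
`F` on one side. -/
theorem exists_even_isInducedPath {X F : Set V} {ε : V → ℕ}
    (hX : ∀ a ∈ X, ∀ b ∈ X, (G.within X).Reachable a b)
    (hF : ∀ f ∈ F, ∀ f' ∈ F, ¬ G.Adj f f') (hFX : ∀ f ∈ F, ∃ x ∈ X, G.Adj f x)
    (hε : ∀ a ∈ X ∪ F, ∀ b ∈ X ∪ F, G.Adj a b → (Even (ε a) ↔ ¬ Even (ε b)))
    (hεF : ∀ f ∈ F, ∀ f' ∈ F, (Even (ε f) ↔ Even (ε f')))
    {z z' : V} (hz : z ∈ F) (hz' : z' ∈ F) (hne : z ≠ z') :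
    ∃ (n : ℕ) (q : ℕ → V), q 0 = z ∧ q n = z' ∧ G.IsInducedPath q n ∧ 2 ≤ n ∧ Even n ∧
      ∀ i, 0 < i → i < n → q i ∈ X := by
  obtain ⟨x, hx, hzx⟩ := hFX z hz
  obtain ⟨x', hx', hzx'⟩ := hFX z' hz'
  obtain ⟨n, q, h0, hn, hq, hqX⟩ :=
    exists_isInducedPath_interior (reachable_within_of_adj hX hx hx' hzx hzx')
  have hmem : ∀ i ≤ n, q i ∈ X ∪ F := by
    intro i hi
    rcases Nat.eq_zero_or_pos i with rfl | hi0
    · exact Or.inr (h0 ▸ hz)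
    · rcases hi.lt_or_eq with h | rfl
      · exact Or.inl (hqX i hi0 h)
      · exact Or.inr (hn ▸ hz')
  have hpar : ∀ i ≤ n, (Even (ε (q i)) ↔ (Even i ↔ Even (ε z))) := by
    intro i
    induction i with
    | zero => intro _; simp [h0]
    | succ i ih =>
      intro hi
      have h1 := ih (by omega)
      have h2 := hε _ (hmem i (by omega)) _ (hmem (i + 1) hi)
        ((hq i (i + 1) (by omega) hi).2.mpr rfl)
      rw [Nat.even_add_one]
      tauto
  refine ⟨n, q, h0, hn, hq, ?_, ?_, hqX⟩
  · by_contra hlt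
    have : n = 0 ∨ n = 1 := by omega
    rcases this with rfl | rfl
    · exact hne (h0.symm.trans hn)
    · have := (hq 0 1 (by omega) le_rfl).2.mpr rfl
      rw [h0, hn] at this
      exact hF z hz z' hz' this
  · have h1 := hpar n le_rfl
    rw [hn] at h1
    have := hεF z hz z' hz'
    tauto

/-- Take an odd hole `c` in `A` and a shortest odd arc, of length `g`, whose two ends share a
neighbour `z` in `F`. The absence of long even holes rules out `g = m`, then `g ≥ 5`, and finally `g
= 3`. -/
theorem colorable_two_of_cover {X F A : Set V} {ε : V → ℕ} (h3 : G.CliqueFree 3)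
    (hG : G.NoLongEvenHole)
    (hX : ∀ a ∈ X, ∀ b ∈ X, (G.within X).Reachable a b)
    (hF : ∀ f ∈ F, ∀ f' ∈ F, ¬ G.Adj f f') (hFX : ∀ f ∈ F, ∃ x ∈ X, G.Adj f x)
    (hε : ∀ a ∈ X ∪ F, ∀ b ∈ X ∪ F, G.Adj a b → (Even (ε a) ↔ ¬ Even (ε b)))
    (hεF : ∀ f ∈ F, ∀ f' ∈ F, (Even (ε f) ↔ Even (ε f')))
    (hXA : ∀ x ∈ X, ∀ a ∈ A, x ≠ a ∧ ¬ G.Adj x a) (hAF : ∀ a ∈ A, ∃ f ∈ F, G.Adj f a) :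
    (G.within A).Colorable 2 := by
  classical
  by_contra hA
  obtain ⟨m, c, hmo, hm5, hcA, hper, hadj, hinj, hchord⟩ := exists_odd_hole h3 hA
  have hFA : ∀ f ∈ F, ∀ i, f ≠ c i := by
    rintro f hf i rfl
    obtain ⟨x, hx, h⟩ := hFX _ hf
    exact (hXA x hx _ (hcA i)).2 h.symm
  have tri : ∀ {z i}, G.Adj z (c i) → ¬ G.Adj z (c (i + 1)) := fun h =>
    h3.not_adj_of_common h (hadj _)
  -- two vertices of `F` attached to the ends of an arc of even length
  have switch : ∀ z ∈ F, ∀ z' ∈ F, ∀ p d, Even d → 2 ≤ d → d + 2 ≤ m →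
      G.Adj z (c p) → G.Adj z' (c (p + d)) →
      (∀ e, 0 < e → e ≤ d → ¬ G.Adj z (c (p + e))) →
      (∀ e < d, ¬ G.Adj z' (c (p + e))) → False := by
    intro z hz z' hz' p d hd hd2 hdm hzp hzp' hzn hzn'
    have hne : z ≠ z' := by
      rintro rfl
      exact hzn d (by omega) le_rfl hzp'
    obtain ⟨n, q, hq0, hqn, hq, hn2, hne2, hqX⟩ :=
      exists_even_isInducedPath hX hF hFX hε hεF hz hz' hne
    let s : ℕ → V := fun k => if k = 0 then z else if k = d + 2 then z' else c (p + (k - 1))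
    have hs : G.IsInducedPath s (d + 2) := by
      intro i j hij hj
      rcases Nat.eq_zero_or_pos i with rfl | hi0
      · rcases hj.lt_or_eq with h | rfl
        · simp only [s, if_true, h.ne, if_false, (show j ≠ 0 by omega)]
          refine ⟨hFA z hz _, ?_⟩
          constructor
          · intro h1
            by_contra h2
            exact hzn (j - 1) (by omega) (by omega) h1
          · rintro rfl
            exact hzp
        · simp only [s, if_true, if_false, (show d + 2 ≠ 0 by omega)]
          exact ⟨hne, iff_of_false (hF z hz z' hz') (by omega)⟩
      · rcases hj.lt_or_eq with h | rfl
        · simp only [s, if_false, h.ne, (show j ≠ 0 by omega), (show i ≠ 0 by omega),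
            (show i ≠ d + 2 by omega)]
          refine ⟨hinj _ _ (by omega) (by omega), ?_⟩
          constructor
          · intro h1
            by_contra h2
            exact hchord _ _ (by omega) (by omega) h1
          · rintro rfl
            have := hadj (p + (i - 1))
            rwa [show p + (i - 1) + 1 = p + (i + 1 - 1) by omega] at this
        · simp only [s, if_true, if_false, (show i ≠ 0 by omega),
            (show i ≠ d + 2 by omega), (show d + 2 ≠ 0 by omega)]
          refine ⟨(hFA z' hz' _).symm, ?_⟩
          constructor
          · intro h1
            by_contra h2
            exact hzn' (i - 1) (by omega) h1.symm
          · intro h1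
            rw [show i - 1 = d by omega]
            exact hzp'.symm
    -- The arc extended by `z` and `z'` has length `d + 2 ≥ 4`, the return path through `X` has even
    -- length `n ≥ 2`, and no edge joins `X` to the arc.
    refine hG (d + 2 + n) (by omega) ?_ (cycleGraph_isIndContained_of_paths hs hq
      (by simp [s, hq0]) (by simp [s, hqn]) (by omega) hn2 ?_)
    · exact (hd.add (by decide)).add hne2
    · intro i j hi hid hj hjn
      simp only [s, if_false, hid.ne, (show i ≠ 0 by omega)]
      have := hXA _ (hqX j hj hjn) _ (hcA (p + (i - 1)))
      exact ⟨this.1.symm, fun h => this.2 h.symm⟩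
  -- the shortest odd distance between two neighbours on the cycle of a vertex of `F`
  let P : ℕ → Prop := fun g => Odd g ∧ ∃ z ∈ F, ∃ a, G.Adj z (c a) ∧ G.Adj z (c (a + g))
  have hPm : P m := by
    obtain ⟨z, hz, h⟩ := hAF _ (hcA 0)
    exact ⟨hmo, z, hz, 0, h, by rw [hper]; exact h⟩
  have hex : ∃ g, P g := ⟨m, hPm⟩
  obtain ⟨hgo, z, hz, a, hza, hzb⟩ := Nat.find_spec hex
  have hgm : Nat.find hex ≤ m := Nat.find_min' hex hPm
  have hmin : ∀ d, d < Nat.find hex → ¬ P d := fun d hd => Nat.find_min hex hd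
  generalize Nat.find hex = g at *
  have hmin' : ∀ z' ∈ F, ∀ i j, Odd j → j < g → G.Adj z' (c i) → ¬ G.Adj z' (c (i + j)) :=
    fun z' hz' i j hj hjg h h' => hmin j hjg ⟨hj, z', hz', i, h, h'⟩
  have hzint : ∀ i, 0 < i → i < g → ¬ G.Adj z (c (a + i)) := by
    intro i hi hig h
    rcases Nat.even_or_odd i with he | ho
    · refine hmin' z hz (a + i) (g - i) ?_ (by omega) h ?_
      · rw [Nat.odd_iff] at *
        rw [Nat.even_iff] at he
        omega
      · rw [show a + i + (g - i) = a + g by omega]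
        exact hzb
    · exact hmin' z hz a i ho hig hza h
  have hg1 : g ≠ 1 := by
    intro h
    rw [h] at hzb
    exact tri hza hzb
  have hg3 : 3 ≤ g := by
    rw [Nat.odd_iff] at hgo
    omega
  have notboth : ∀ z' ∈ F, ∀ i, 0 < i → i < g → G.Adj z' (c (a + i)) →
      G.Adj z' (c a) → ¬ G.Adj z' (c (a + g)) := by
    intro z' hz' i hi hig h h0 h1
    rcases Nat.even_or_odd i with he | ho
    · refine hmin' z' hz' (a + i) (g - i) ?_ (by omega) h ?_
      · rw [Nat.odd_iff] at *
        rw [Nat.even_iff] at he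
        omega
      · rw [show a + i + (g - i) = a + g by omega]
        exact h1
    · exact hmin' z' hz' a i ho hig h0 h
  -- If `g = m`, then `c a` is the only neighbour of `z` on the hole, and `z` together with a cover
  -- of `c (a + 2)` contradicts `switch`.
  have hgm2 : g + 2 ≤ m := by
    by_contra hlt
    have hgm' : g = m := by
      rw [Nat.odd_iff] at *
      omega
    obtain ⟨z', hz', h⟩ := hAF _ (hcA (a + 2))
    have hz'0 : ¬ G.Adj z' (c a) := fun h0 => by
      refine notboth z' hz' 2 (by omega) (by omega) h h0 ?_
      rw [hgm', hper]
      exact h0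
    refine switch z hz z' hz' a 2 (by decide) le_rfl (by omega) hza h
      (fun e he he2 => hzint e he (by omega)) (fun e he => ?_)
    interval_cases e
    · exact hz'0
    · exact fun h1 => tri h1 h
  -- If `z'` missed both ends of the arc, its first and last neighbours inside would be at odd
  -- distance from the respective ends, by `switch`. As `g` is odd, they would then be at odd
  -- distance less than `g` from each other.
  have oneof : ∀ z' ∈ F, ∀ i, 0 < i → i < g → G.Adj z' (c (a + i)) →
      ¬ G.Adj z' (c a) → G.Adj z' (c (a + g)) := by
    intro z' hz' i hi hig h h0
    by_contra h1
    have hexi : ∃ i, 0 < i ∧ i < g ∧ G.Adj z' (c (a + i)) := ⟨i, hi, hig, h⟩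
    have hexj : ∃ j, 0 < j ∧ j < g ∧ G.Adj z' (c (a + (g - j))) :=
      ⟨g - i, by omega, by omega, by rwa [show g - (g - i) = i by omega]⟩
    obtain ⟨hi0, hi1, hi2⟩ := Nat.find_spec hexi
    obtain ⟨hj0, hj1, hj2⟩ := Nat.find_spec hexj
    have hii : Nat.find hexi ≤ i := Nat.find_min' hexi ⟨hi, hig, h⟩
    have hji : Nat.find hexj ≤ g - i := Nat.find_min' hexj
      ⟨by omega, by omega, by rwa [show g - (g - i) = i by omega]⟩
    have hmi : ∀ k, k < Nat.find hexi → ¬ (0 < k ∧ k < g ∧ G.Adj z' (c (a + k))) :=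
      fun k hk => Nat.find_min hexi hk
    have hmj : ∀ k, k < Nat.find hexj → ¬ (0 < k ∧ k < g ∧ G.Adj z' (c (a + (g - k)))) :=
      fun k hk => Nat.find_min hexj hk
    set i0 := Nat.find hexi
    set j0 := Nat.find hexj
    have hi0o : Odd i0 := by
      by_contra he
      rw [Nat.not_odd_iff_even] at he
      refine switch z hz z' hz' a i0 he ?_ (by omega) hza hi2
        (fun e he he2 => hzint e he (by omega)) (fun e he => ?_)
      · rw [Nat.even_iff] at he
        omega
      · rcases Nat.eq_zero_or_pos e with rfl | he0
        · exact h0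
        · exact fun h' => hmi e he ⟨he0, by omega, h'⟩
    have hj0o : Odd j0 := by
      by_contra he
      rw [Nat.not_odd_iff_even] at he
      refine switch z' hz' z hz (a + (g - j0)) j0 he ?_ (by omega) hj2 ?_
        (fun e he he2 => ?_) (fun e he => ?_)
      · rw [Nat.even_iff] at he
        omega
      · rwa [show a + (g - j0) + j0 = a + g by omega]
      · rw [show a + (g - j0) + e = a + (g - (j0 - e)) by omega]
        rcases Nat.eq_zero_or_pos (j0 - e) with h4 | h4
        · rw [h4]
          exact h1
        · exact fun h' => hmj (j0 - e) (by omega) ⟨h4, by omega, h'⟩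
      · rw [show a + (g - j0) + e = a + (g - j0 + e) by omega]
        exact hzint _ (by omega) (by omega)
    refine hmin' z' hz' (a + i0) (g - j0 - i0) ?_ (by omega) hi2 ?_
    · rw [Nat.odd_iff] at *
      omega
    · rw [show a + i0 + (g - j0 - i0) = a + (g - j0) by omega]
      exact hj2
  -- two vertices of `F` attached to both of two disjoint edges
  have hexagon : ∀ z1 ∈ F, ∀ z2 ∈ F, ∀ p d, 2 ≤ d → d + 4 ≤ m →
      G.Adj z1 (c p) → G.Adj z2 (c (p + 1)) → G.Adj z2 (c (p + 1 + d)) →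
      G.Adj z1 (c (p + 1 + d + 1)) → False := by
    intro z1 hz1 z2 hz2 p d hd2 hdm e1 e2 e3 e4
    exact hG.not_hexagon e1 (hadj p) e2.symm e3 (hadj _) e4.symm (tri e1) (hF z1 hz1 z2 hz2)
      (fun h => tri h e4) (fun h => tri h.symm e2) (hchord _ _ (by omega) (by omega))
      (hchord _ _ (by omega) (by omega)) (hchord _ _ (by omega) (by omega))
      (hchord _ _ (by omega) (by omega)) (fun h => tri e3 h)
  have hexagon' : ∀ z1 ∈ F, ∀ z2 ∈ F, ∀ p d, 2 ≤ d → d + 4 ≤ m →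
      G.Adj z1 (c p) → G.Adj z2 (c (p + 1)) → G.Adj z1 (c (p + 1 + d)) →
      G.Adj z2 (c (p + 1 + d + 1)) → False := by
    intro z1 hz1 z2 hz2 p d hd2 hdm e1 e2 e3 e4
    exact hG.not_hexagon e1 (hadj p) e2.symm e4 (hadj _).symm e3.symm (tri e1)
      (hF z1 hz1 z2 hz2) (tri e3) (fun h => tri h.symm e2)
      (hchord _ _ (by omega) (by omega)) (hchord _ _ (by omega) (by omega))
      (hchord _ _ (by omega) (by omega)) (hchord _ _ (by omega) (by omega)) (fun h => tri h e4)
  obtain ⟨z2, hz2, h2⟩ := hAF _ (hcA (a + 1))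
  have h20 : ¬ G.Adj z2 (c a) := fun h => tri h h2
  have h2g := oneof z2 hz2 1 (by omega) (by omega) h2 h20
  -- For `g ≥ 5`, covers of the second and the penultimate vertex of the arc are attached to
  -- opposite ends of it, which gives a hexagon.
  have hg3' : g = 3 := by
    by_contra hne
    have hg5 : 5 ≤ g := by
      rw [Nat.odd_iff] at hgo
      omega
    obtain ⟨z1, hz1, h1⟩ := hAF _ (hcA (a + (g - 1)))
    have h1g : ¬ G.Adj z1 (c (a + g)) := fun h => by
      refine tri h1 ?_
      rwa [show a + (g - 1) + 1 = a + g by omega]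
    have h10 : G.Adj z1 (c a) := by
      by_contra h
      exact h1g (oneof z1 hz1 (g - 1) (by omega) (by omega) h1 h)
    have e1 : a + 1 + (g - 2) = a + (g - 1) := by omega
    have e2 : a + (g - 1) + 1 = a + g := by omega
    exact hexagon' z1 hz1 z2 hz2 a (g - 2) (by omega) (by omega) h10 h2 (e1 ▸ h1)
      (by rw [e1, e2]; exact h2g)
  rw [hg3'] at h2g oneof
  have zero_of_two : ∀ z' ∈ F, G.Adj z' (c (a + 2)) → G.Adj z' (c a) := by
    intro z' hz' h
    by_contra h0
    exact tri h (oneof z' hz' 2 (by omega) (by omega) h h0)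
  -- For `m = 5` the vertices `c (a + 4)` and `c a` are adjacent, so there would be a triangle; for
  -- larger `m` there is a hexagon through `z2`.
  have not_zero_four : ∀ z' ∈ F, G.Adj z' (c a) → ¬ G.Adj z' (c (a + 4)) := by
    intro z' hz' h0 h4
    rcases Nat.lt_or_ge m 6 with hm | hm
    · have h5 := hper a
      rw [show m = 5 by omega] at h5
      refine tri h4 ?_
      rw [show a + 4 + 1 = a + 5 by omega, h5]
      exact h0
    · exact hexagon z' hz' z2 hz2 a 2 le_rfl hm h0 h2 h2g h4
  -- The final contradiction is `switch` on the arc from `c (a + 2)` to `c (a + 4)`, just past the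
  -- middle of the short arc.
  obtain ⟨z1, hz1, h1⟩ := hAF _ (hcA (a + 2))
  obtain ⟨y, hy, hy4⟩ := hAF _ (hcA (a + 4))
  have hy2 : ¬ G.Adj y (c (a + 2)) := fun h => not_zero_four y hy (zero_of_two y hy h) hy4
  refine switch z1 hz1 y hy (a + 2) 2 (by decide) le_rfl (by omega) h1 hy4
    (fun e he he2 => ?_) (fun e he => ?_)
  · interval_cases e
    · exact tri h1
    · exact not_zero_four z1 hz1 (zero_of_two z1 hz1 h1)
  · interval_cases e
    · exact hy2
    · exact fun h => tri h hy4

/-! ### Distance levels and colourings of balls -/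

theorem within_colorable_mono {S T : Set V} {n : ℕ} (h : S ⊆ T) (hT : (G.within T).Colorable n) :
    (G.within S).Colorable n :=
  hT.mono_left (within_mono h)

theorem within_union_colorable {S T : Set V} {a b : ℕ} (hS : (G.within S).Colorable a)
    (hT : (G.within T).Colorable b) : (G.within (S ∪ T)).Colorable (a + b) := by
  classical
  obtain ⟨C⟩ := hS
  obtain ⟨D⟩ := hT
  have : (G.within (S ∪ T)).Coloring (Fin a ⊕ Fin b) :=
    Coloring.mk (fun v => if v ∈ S then Sum.inl (C v) else Sum.inr (D v)) (by
      rintro u w ⟨hu, hw, huw⟩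
      by_cases h1 : u ∈ S <;> by_cases h2 : w ∈ S
      · simpa [h1, h2] using C.valid ⟨h1, h2, huw⟩
      · simp [h1, h2]
      · simp [h1, h2]
      · simpa [h1, h2] using D.valid ⟨hu.resolve_left h1, hw.resolve_left h2, huw⟩)
  simpa using this.colorable

/-- The vertices at distance exactly `k` from `v`. -/
def level (G : SimpleGraph V) (v : V) (k : ℕ) : Set V := {u | G.edist v u = k}

theorem level_adj_le {v u w : V} {i j : ℕ} (hu : u ∈ G.level v i) (hw : w ∈ G.level v j)
    (h : G.Adj u w) : j ≤ i + 1 := by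
  have h1 := G.edist_triangle (u := v) (v := u) (w := w)
  rw [show G.edist v u = i from hu, show G.edist v w = j from hw,
    edist_eq_one_iff_adj.mpr h] at h1
  exact_mod_cast h1

theorem exists_level_of_adj {v u w : V} {i : ℕ} (hu : u ∈ G.level v i) (h : G.Adj u w) :
    ∃ j, w ∈ G.level v j ∧ j ≤ i + 1 ∧ i ≤ j + 1 := by
  have hr : G.edist v w ≠ ⊤ := by
    rw [edist_ne_top_iff_reachable]
    exact (reachable_of_edist_ne_top (by rw [show G.edist v u = i from hu]; simp)).trans
      h.reachable
  obtain ⟨j, hj⟩ := ENat.ne_top_iff_exists.mp hr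
  exact ⟨j, hj.symm, level_adj_le hu hj.symm h, level_adj_le hj.symm hu h.symm⟩

theorem exists_parent {v u : V} {k : ℕ} (hu : u ∈ G.level v (k + 1)) :
    ∃ w ∈ G.level v k, G.Adj w u := by
  obtain ⟨p, hp⟩ := exists_walk_of_edist_eq_coe hu
  have hadj := p.adj_getVert_succ (i := k) (by omega)
  rw [show k + 1 = p.length by omega, p.getVert_length] at hadj
  refine ⟨p.getVert k, ?_, hadj⟩
  obtain ⟨j, hj, hj1, hj2⟩ := exists_level_of_adj hu hadj.symm
  have h1 := edist_le (p.take k)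
  rw [Walk.take_length, show G.edist v (p.getVert k) = j from hj] at h1
  have h2 : j ≤ min k p.length := by exact_mod_cast h1
  obtain rfl : j = k := by omega
  exact hj

theorem level_unique {v u : V} {i j : ℕ} (hi : u ∈ G.level v i) (hj : u ∈ G.level v j) : i = j := by
  have : (i : ℕ∞) = j := hi.symm.trans hj
  exact_mod_cast this

/-- A stable part `Y` of level `k + 1`, attached to a connected set `X` in the lower levels such
that no edge of `X ∪ Y` joins two vertices of the same level. -/
structure IsGoodPart (G : SimpleGraph V) (v : V) (k : ℕ) (X Y : Set V) : Prop where
  below : ∀ x ∈ X, ∃ j ≤ k, x ∈ G.level v j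
  mem : ∀ y ∈ Y, y ∈ G.level v (k + 1)
  conn : ∀ a ∈ X, ∀ b ∈ X, (G.within X).Reachable a b
  attach : ∀ y ∈ Y, ∃ x ∈ X, G.Adj y x
  cross : ∀ a ∈ X ∪ Y, ∀ b ∈ X ∪ Y, G.Adj a b → ∀ j, a ∈ G.level v j → b ∉ G.level v j

/-- Parity of the distance from `v` is the bipartition of `X ∪ Y`, and level `k + 2` is too far out
to see `X`. -/
theorem IsGoodPart.colorable_two {v : V} {k : ℕ} {X Y : Set V} (h : G.IsGoodPart v k X Y)
    (h3 : G.CliqueFree 3) (hG : G.NoLongEvenHole) :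
    (G.within {u | u ∈ G.level v (k + 2) ∧ ∃ y ∈ Y, G.Adj y u}).Colorable 2 := by
  have hlev : ∀ {u i}, u ∈ G.level v i → (G.edist v u).toNat = i := fun {u i} hu => by
    rw [show G.edist v u = i from hu]; rfl
  refine colorable_two_of_cover (X := X) (F := Y) (ε := fun u => (G.edist v u).toNat)
    h3 hG h.conn ?_ h.attach ?_ ?_ ?_ (fun a ha => ha.2)
  · intro f hf f' hf' hadj
    exact h.cross f (Or.inr hf) f' (Or.inr hf') hadj _ (h.mem f hf) (h.mem f' hf')
  · intro a ha b hb hab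
    have hla : ∃ i, a ∈ G.level v i := by
      rcases ha with ha | ha
      · obtain ⟨j, -, hj⟩ := h.below a ha
        exact ⟨j, hj⟩
      · exact ⟨_, h.mem a ha⟩
    obtain ⟨i, hi⟩ := hla
    obtain ⟨j, hj, hj1, hj2⟩ := exists_level_of_adj hi hab
    have hne : i ≠ j := fun he => h.cross a ha b hb hab i hi (he ▸ hj)
    simp only [hlev hi, hlev hj, Nat.even_iff]
    omega
  · intro f hf f' hf'
    simp only [hlev (h.mem f hf), hlev (h.mem f' hf')]
  · intro x hx a ha
    obtain ⟨j, hjk, hj⟩ := h.below x hx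
    refine ⟨?_, fun hadj => ?_⟩
    · rintro rfl
      have := level_unique hj ha.1
      omega
    · have := level_adj_le hj ha.1 hadj
      omega

/-- Each vertex of the next level chooses a parent. The children of one parent class `Y` induce a
bipartite graph, and each side of it is again good, with `X ∪ Y` as the connected set. Thus the
number of colours doubles with each level. -/
theorem exists_goodParts (h3 : G.CliqueFree 3) (hG : G.NoLongEvenHole) (v : V) (k : ℕ) :
    ∃ C : V → ℕ, (∀ u, C u < 2 ^ k) ∧
      ∀ i, ∃ X, G.IsGoodPart v k X {u | u ∈ G.level v (k + 1) ∧ C u = i} := by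
  classical
  induction k with
  | zero =>
    have hv : v ∈ G.level v 0 := by simp [level]
    have hv' : ∀ u ∈ G.level v 0, u = v := fun u hu => (edist_eq_zero_iff.mp hu).symm
    refine ⟨fun _ => 0, by simp, fun i => ⟨{v}, ?_, ?_, ?_, ?_, ?_⟩⟩
    · rintro x rfl
      exact ⟨0, le_rfl, hv⟩
    · exact fun y hy => hy.1
    · rintro a rfl b rfl
      rfl
    · rintro y ⟨hy, -⟩
      obtain ⟨w, hw, h⟩ := exists_parent hy
      obtain rfl := hv' w hw
      exact ⟨w, rfl, h.symm⟩
    · rintro a ha b hb hab j hja hjb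
      have hval : ∀ a ∈ ({v} : Set V) ∪ {u | u ∈ G.level v (0 + 1) ∧ 0 = i},
          a ∈ G.level v j → (j = 0 ∧ a = v) ∨ (j = 1 ∧ G.Adj v a) := by
        rintro a (rfl | ha) h
        · exact Or.inl ⟨level_unique h hv, rfl⟩
        · exact Or.inr ⟨level_unique h ha.1, edist_eq_one_iff_adj.mp ha.1⟩
      rcases hval a ha hja with ⟨h1, h2⟩ | ⟨h1, h2⟩ <;>
        rcases hval b hb hjb with ⟨h3', h4⟩ | ⟨h3', h4⟩
      · subst h2 h4
        exact G.loopless.irrefl _ hab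
      · omega
      · omega
      · exact h3.not_adj_of_common h2 hab h4
  | succ k ih =>
    obtain ⟨C, hC, hgood⟩ := ih
    choose X hX using hgood
    have hcol := fun i => (hX i).colorable_two h3 hG
    have D := fun i => (hcol i).some
    have hpar : ∀ u, ∃ w, u ∈ G.level v (k + 2) → w ∈ G.level v (k + 1) ∧ G.Adj w u := by
      intro u
      by_cases hu : u ∈ G.level v (k + 2)
      · obtain ⟨w, hw, h⟩ := exists_parent hu
        exact ⟨w, fun _ => ⟨hw, h⟩⟩
      · exact ⟨u, fun h => absurd h hu⟩
    choose π hπ using hpar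
    -- The colour encodes the parent's class together with one binary digit for the side of the
    -- bipartition; `hdec` decodes it.
    refine ⟨fun u => 2 * C (π u) + D (C (π u)) u, fun u => ?_, fun i => ?_⟩
    · have h1 := hC (π u)
      have h2 := (D (C (π u)) u).2
      change 2 * C (π u) + (D (C (π u)) u : ℕ) < _
      rw [pow_succ]
      omega
    · have hdec : ∀ u, 2 * C (π u) + (D (C (π u)) u : ℕ) = i →
          C (π u) = i / 2 ∧ (D (i / 2) u : ℕ) = i % 2 := by
        intro u hu
        have h2 := (D (C (π u)) u).2
        have h1 : C (π u) = i / 2 := by omega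
        rw [h1] at hu
        exact ⟨h1, by omega⟩
      set Y : Set V := {u | u ∈ G.level v (k + 1) ∧ C u = i / 2} with hY
      have hg := hX (i / 2)
      have hmemY : ∀ u, u ∈ G.level v (k + 2) → 2 * C (π u) + (D (C (π u)) u : ℕ) = i →
          π u ∈ Y ∧ G.Adj (π u) u := fun u hu hi =>
        ⟨⟨(hπ u hu).1, (hdec u hi).1⟩, (hπ u hu).2⟩
      refine ⟨X (i / 2) ∪ Y, ?_, fun y hy => hy.1, ?_, ?_, ?_⟩
      · rintro x (hx | hx)
        · obtain ⟨j, hj, h⟩ := hg.below x hx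
          exact ⟨j, by omega, h⟩
        · exact ⟨k + 1, le_rfl, hx.1⟩
      · have hto : ∀ a ∈ X (i / 2) ∪ Y, ∃ x ∈ X (i / 2),
            (G.within (X (i / 2) ∪ Y)).Reachable a x := by
          rintro a (ha | ha)
          · exact ⟨a, ha, .rfl⟩
          · obtain ⟨x, hx, h⟩ := hg.attach a ha
            have h' : (G.within (X (i / 2) ∪ Y)).Adj a x := ⟨Or.inr ha, Or.inl hx, h⟩
            exact ⟨x, hx, h'.reachable⟩
        intro a ha b hb
        obtain ⟨x, hx, hax⟩ := hto a ha
        obtain ⟨y, hy, hby⟩ := hto b hb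
        exact (hax.trans ((hg.conn x hx y hy).mono (within_mono Set.subset_union_left))).trans
          hby.symm
      · rintro y ⟨hy, hyi⟩
        obtain ⟨h1, h2⟩ := hmemY y hy hyi
        exact ⟨_, Or.inr h1, h2.symm⟩
      · intro a ha b hb hab j hja hjb
        have htop : ∀ a, a ∈ X (i / 2) ∪ Y → a ∉ G.level v (k + 2) := by
          rintro a (ha | ha) h
          · obtain ⟨j, hj, h'⟩ := hg.below a ha
            have := level_unique h h'
            omega
          · have := level_unique h ha.1
            omega
        rcases ha with ha | ha <;> rcases hb with hb | hb
        · exact hg.cross a ha b hb hab j hja hjb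
        · obtain rfl := level_unique hjb hb.1
          exact htop a ha hja
        · obtain rfl := level_unique hja ha.1
          exact htop b hb hjb
        · have h1 := hmemY a ha.1 ha.2
          have h2 := hmemY b hb.1 hb.2
          refine (D (i / 2)).valid (show (G.within _).Adj a b from
            ⟨⟨ha.1, _, h1⟩, ⟨hb.1, _, h2⟩, hab⟩) (Fin.ext ?_)
          rw [(hdec a ha.2).2, (hdec b hb.2).2]

theorem level_colorable (h3 : G.CliqueFree 3) (hG : G.NoLongEvenHole) (v : V) (k : ℕ) :
    (G.within (G.level v (k + 1))).Colorable (2 ^ k) := by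
  obtain ⟨C, hC, hgood⟩ := exists_goodParts h3 hG v k
  refine ⟨Coloring.mk (fun u => ⟨C u, hC u⟩) ?_⟩
  rintro u w ⟨hu, hw, huw⟩ he
  obtain ⟨X, hX⟩ := hgood (C u)
  exact hX.cross u (Or.inr ⟨hu, rfl⟩) w (Or.inr ⟨hw, (Fin.mk.inj he).symm⟩) huw _ hu hw

/-- The centre takes one colour and level `k + 1` takes `2 ^ k`; these add up to `2 ^ r`. -/
theorem edist_le_colorable (h3 : G.CliqueFree 3) (hG : G.NoLongEvenHole) (v : V) (r : ℕ) :
    (G.within {u | G.edist v u ≤ r}).Colorable (2 ^ r) := by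
  induction r with
  | zero =>
    refine ⟨Coloring.mk (fun _ => 0) ?_⟩
    rintro u w ⟨hu, hw, huw⟩
    have hu' : u = v := by simpa using hu
    have hw' : w = v := by simpa using hw
    subst hu' hw'
    exact absurd huw (G.loopless.irrefl _)
  | succ r ih =>
    rw [pow_succ, mul_two]
    refine within_colorable_mono ?_ (within_union_colorable ih (level_colorable h3 hG v r))
    intro u hu
    rcases lt_or_eq_of_le (show G.edist v u ≤ ((r + 1 : ℕ) : ℕ∞) from hu) with h | h
    · left
      have : ((r + 1 : ℕ) : ℕ∞) = (r : ℕ∞) + 1 := by norm_cast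
      rw [this] at h
      exact Order.le_of_lt_add_one h
    · exact Or.inr h

/-! ### Systems inside sets of large chromatic number -/

/-- A connected set `X` inside `S`, together with a set `A` inside `S` all of whose vertices `u` are
joined to `X` by a path `u, f u, g u` such that `X` sees only `g u` and `A` only `f u`. -/
structure IsSystem (G : SimpleGraph V) (S A X : Set V) (f g : V → V) : Prop where
  A_sub : A ⊆ S
  X_sub : X ⊆ S
  f_mem : ∀ u ∈ A, f u ∈ S
  g_mem : ∀ u ∈ A, g u ∈ S
  conn : ∀ a ∈ X, ∀ b ∈ X, (G.within X).Reachable a b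
  adj_f : ∀ u ∈ A, G.Adj u (f u)
  adj_g : ∀ u ∈ A, G.Adj (f u) (g u)
  adj_X : ∀ u ∈ A, ∃ x ∈ X, G.Adj (g u) x
  A_X : ∀ u ∈ A, ∀ x ∈ X, u ≠ x ∧ ¬ G.Adj u x
  f_A : ∀ u ∈ A, f u ∉ A
  g_A : ∀ u ∈ A, ∀ w ∈ A, g u ≠ w ∧ ¬ G.Adj (g u) w

/-- Edges stay inside a level or join consecutive ones, so colourings of the levels combine with the
parity of the level. A root is chosen in each component. -/
theorem exists_level_not_colorable {n : ℕ} (h : ¬ G.Colorable (2 * n)) :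
    ∃ v k, ¬ (G.within (G.level v k)).Colorable n := by
  by_contra hcon
  push Not at hcon
  have C := fun v k => (hcon v k).some
  let r : V → V := fun u => (G.connectedComponentMk u).out
  have hr : ∀ u, G.Reachable (r u) u := fun u =>
    ConnectedComponent.exact (Quot.out_eq (G.connectedComponentMk u))
  have hlev : ∀ u, u ∈ G.level (r u) (G.dist (r u) u) := fun u => ((hr u).coe_dist_eq_edist).symm
  refine h ?_
  have : G.Coloring (Fin 2 × Fin n) :=
    Coloring.mk (fun u => (⟨G.dist (r u) u % 2, Nat.mod_lt _ (by omega)⟩,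
      C (r u) (G.dist (r u) u) u)) (by
      intro u w huw he
      have hrr : r u = r w := by
        simp only [r]
        rw [ConnectedComponent.sound huw.reachable]
      have h1 := hlev u
      have h2 := hlev w
      rw [← hrr] at h2
      have he1 := Fin.mk.inj (Prod.mk.inj he).1
      have he2 := (Prod.mk.inj he).2
      rw [← hrr] at he1 he2
      have h3 := level_adj_le h1 h2 huw
      have h4 := level_adj_le h2 h1 huw.symm
      have h5 : G.dist (r u) u = G.dist (r u) w := by omega
      rw [← h5] at h2 he2
      exact (C (r u) (G.dist (r u) u)).valid ⟨h1, h2, huw⟩ he2)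
  simpa using this.colorable

theorem reachable_lower_levels {v x : V} {i j : ℕ} (hij : i ≤ j) (hx : x ∈ G.level v i) :
    (G.within {u | ∃ i ≤ j, u ∈ G.level v i}).Reachable x v := by
  induction i generalizing x with
  | zero =>
    obtain rfl := edist_eq_zero_iff.mp hx
    rfl
  | succ i ih =>
    obtain ⟨w, hw, h⟩ := exists_parent hx
    have h' : (G.within {u | ∃ i ≤ j, u ∈ G.level v i}).Adj x w :=
      ⟨⟨i + 1, hij, hx⟩, ⟨i, by omega, hw⟩, h.symm⟩
    exact h'.reachable.trans (ih (by omega) hw)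

/-- `A` is a level of large chromatic number in the graph on `S`, `f` and `g` pick a parent and a
grandparent, and `X` is everything below the grandparents. The gaps between levels give the required
non-adjacencies. -/
theorem exists_isSystem {S : Set V} {n : ℕ} (h : ¬ (G.within S).Colorable (2 * n))
    (hball : ∀ v, (G.within {u | G.edist v u ≤ (2 : ℕ)}).Colorable n) :
    ∃ A X f g, G.IsSystem S A X f g ∧ ¬ (G.within A).Colorable n := by
  obtain ⟨v, k, hk⟩ := exists_level_not_colorable h
  set H := G.within S with hH
  have hA : ¬ (G.within (H.level v k)).Colorable n := by
    refine fun hc => hk (hc.mono_left ?_)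
    exact fun a b hab => ⟨hab.1, hab.2.1, hab.2.2.2.2⟩
  -- Distances in `H` are at least those in `G`, so a level up to 2 lies in a ball of radius 2 of
  -- `G`, which is `n`-colourable.
  have hk3 : 3 ≤ k := by
    by_contra hlt
    refine hA (within_colorable_mono ?_ (hball v))
    intro u hu
    refine (edist_anti (within_le (G := G) (S := S))).trans ?_
    rw [show (G.within S).edist v u = k from hu]
    exact_mod_cast (by omega : k ≤ 2)
  obtain ⟨j, rfl⟩ : ∃ j, k = j + 3 := ⟨k - 3, by omega⟩
  have hvS : v ∈ S := by
    have hne : (H.level v (j + 3)).Nonempty := by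
      by_contra hempty
      rw [Set.not_nonempty_iff_eq_empty] at hempty
      exact hA (within_colorable_mono (by simp [hempty]) (hball v))
    obtain ⟨u, hu⟩ := hne
    obtain ⟨p, -⟩ := exists_walk_of_edist_eq_coe hu
    obtain ⟨w, -, hw⟩ := exists_parent hu
    exact mem_of_within_walk p.reverse hw.2.1
  have hlS : ∀ {i u}, u ∈ H.level v i → u ∈ S := by
    intro i u hu
    obtain ⟨p, -⟩ := exists_walk_of_edist_eq_coe hu
    exact mem_of_within_walk p hvS
  have hadj : ∀ {i i' u w}, u ∈ H.level v i → w ∈ H.level v i' → G.Adj u w → i' ≤ i + 1 :=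
    fun hu hw huw => level_adj_le hu hw ⟨hlS hu, hlS hw, huw⟩
  have hanc : ∀ u, ∃ f g, u ∈ H.level v (j + 3) → f ∈ H.level v (j + 2) ∧
      g ∈ H.level v (j + 1) ∧ G.Adj u f ∧ G.Adj f g := by
    intro u
    by_cases hu : u ∈ H.level v (j + 3)
    · obtain ⟨f, hf, hfu⟩ := exists_parent hu
      obtain ⟨g, hg, hgf⟩ := exists_parent hf
      exact ⟨f, g, fun _ => ⟨hf, hg, hfu.2.2.symm, hgf.2.2.symm⟩⟩
    · exact ⟨u, u, fun h => absurd h hu⟩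
  choose f g hfg using hanc
  refine ⟨H.level v (j + 3), {u | ∃ i ≤ j, u ∈ H.level v i}, f, g, ?_, hA⟩
  refine ⟨fun u => hlS, ?_, fun u hu => hlS (hfg u hu).1, fun u hu => hlS (hfg u hu).2.1, ?_,
    fun u hu => (hfg u hu).2.2.1, fun u hu => (hfg u hu).2.2.2, ?_, ?_, ?_, ?_⟩
  · rintro x ⟨i, -, hx⟩
    exact hlS hx
  · rintro a ⟨i, hi, ha⟩ b ⟨i', hi', hb⟩
    refine ((reachable_lower_levels hi ha).trans (reachable_lower_levels hi' hb).symm).mono ?_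
    exact fun a b hab => ⟨hab.1, hab.2.1, hab.2.2.2.2⟩
  · intro u hu
    obtain ⟨x, hx, h⟩ := exists_parent (hfg u hu).2.1
    exact ⟨x, ⟨j, le_rfl, hx⟩, h.2.2.symm⟩
  · rintro u hu x ⟨i, hi, hx⟩
    refine ⟨?_, fun h => ?_⟩
    · rintro rfl
      have := level_unique hu hx
      omega
    · have := hadj hx hu h.symm
      omega
  · intro u hu h
    have := level_unique h (hfg u hu).1
    omega
  · intro u hu w hw
    refine ⟨?_, fun h => ?_⟩
    · rintro rfl
      have := level_unique hw (hfg u hu).2.1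
      omega
    · have := hadj (hfg u hu).2.1 hw h
      omega

/-! ### Tripods -/

/-- No vertex of `S` equals or is adjacent to a vertex of `T`. -/
def Anticomplete (G : SimpleGraph V) (S T : Set V) : Prop :=
  ∀ a ∈ S, ∀ b ∈ T, a ≠ b ∧ ¬ G.Adj a b

theorem Anticomplete.mono {S T T' : Set V} (h : G.Anticomplete S T) (hT : T' ⊆ T) :
    G.Anticomplete S T' :=
  fun a ha b hb => h a ha b (hT hb)

/-- Near `u` there is a vertex `c` with links to the three sets `X i` that do not interfere with
each other. -/
def IsTripod (G : SimpleGraph V) (X : Fin 3 → Set V) (u : V) : Prop :=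
  ∃ (c : V) (B : Fin 3 → Set V), G.edist u c ≤ 2 ∧ (∀ i, ∀ b ∈ B i, G.edist u b ≤ 2) ∧
    (∀ i j, i < j → G.Anticomplete (B i ∪ X i) (B j ∪ X j)) ∧
    ∀ i, ∃ x ∈ X i, (G.within (insert c (B i ∪ X i))).Reachable c x

theorem two_lt_edist_of_far {u t a b : V} (hut : 6 < G.edist u t) (ha : G.edist u a ≤ 2)
    (hb : G.edist t b ≤ 2) : 2 < G.edist a b := by
  by_contra h
  rw [not_lt] at h
  rw [edist_comm] at hb
  have h1 : G.edist u t ≤ G.edist u a + (G.edist a b + G.edist b t) :=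
    (G.edist_triangle (v := a)).trans (by gcongr; exact G.edist_triangle)
  have h2 : G.edist u a + (G.edist a b + G.edist b t) ≤ 2 + (2 + 2) := by gcongr
  refine absurd (h1.trans h2) (not_le.mpr (lt_of_eq_of_lt ?_ hut))
  norm_num

/-- At distance more than 6 the local parts of the two tripods, of radius 2, do not touch. Joining
corresponding links through each `X i` gives three induced paths from `c` to `c'` with pairwise
anticomplete interiors, and two of them have lengths of the same parity. -/
theorem IsTripod.edist_le {X : Fin 3 → Set V} {u t : V} (hG : G.NoLongEvenHole)
    (hX : ∀ i, ∀ a ∈ X i, ∀ b ∈ X i, (G.within (X i)).Reachable a b)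
    (hu : G.IsTripod X u) (ht : G.IsTripod X t) : G.edist u t ≤ 6 := by
  by_contra hut
  rw [not_le] at hut
  obtain ⟨c, B, hc, hB, hanti, hlink⟩ := hu
  obtain ⟨c', B', hc', hB', hanti', hlink'⟩ := ht
  have hcc := two_lt_edist_iff.mp (two_lt_edist_of_far hut hc hc')
  let S : Fin 3 → Set V := fun i => (B i ∪ X i) ∪ (B' i ∪ X i)
  have hS : ∀ i j, i < j → G.Anticomplete (S i) (S j) := by
    have hfar : ∀ i j, ∀ a ∈ B i, ∀ b ∈ B' j, a ≠ b ∧ ¬ G.Adj a b := fun i j a ha b hb =>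
      ⟨(two_lt_edist_iff.mp (two_lt_edist_of_far hut (hB i a ha) (hB' j b hb))).1,
        (two_lt_edist_iff.mp (two_lt_edist_of_far hut (hB i a ha) (hB' j b hb))).2.1⟩
    rintro i j hij a (ha | ha) b (hb | hb)
    · exact hanti i j hij a ha b hb
    · rcases ha with ha | ha
      · rcases hb with hb | hb
        · exact hfar i j a ha b hb
        · exact hanti i j hij a (Or.inl ha) b (Or.inr hb)
      · exact hanti' i j hij a (Or.inr ha) b hb
    · rcases hb with hb | hb
      · rcases ha with ha | ha
        · exact ⟨(hfar j i b hb a ha).1.symm, fun h => (hfar j i b hb a ha).2 h.symm⟩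
        · exact hanti i j hij a (Or.inr ha) b (Or.inl hb)
      · exact hanti' i j hij a ha b (Or.inr hb)
    · exact hanti' i j hij a ha b hb
  have hpath : ∀ i, ∃ (n : ℕ) (p : ℕ → V), p 0 = c ∧ p n = c' ∧ G.IsInducedPath p n ∧
      ∀ k, 0 < k → k < n → p k ∈ S i := by
    intro i
    refine exists_isInducedPath_interior ?_
    obtain ⟨x, hx, h⟩ := hlink i
    obtain ⟨x', hx', h'⟩ := hlink' i
    refine ((h.mono (within_mono ?_)).trans ((hX i x hx x' hx').mono (within_mono ?_))).trans
      (h'.mono (within_mono ?_)).symm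
    · intro a ha
      simp only [S, Set.mem_insert_iff, Set.mem_union, Set.mem_singleton_iff] at *
      tauto
    · intro a ha
      simp only [S, Set.mem_insert_iff, Set.mem_union, Set.mem_singleton_iff] at *
      tauto
    · intro a ha
      simp only [S, Set.mem_insert_iff, Set.mem_union, Set.mem_singleton_iff] at *
      tauto
  choose n p hp0 hpn hp hpS using hpath
  -- The centres are distinct, non-adjacent and without common neighbour; two paths therefore make a
  -- cycle of length at least 6.
  have hn : ∀ i, 3 ≤ n i := by
    intro i
    by_contra hlt
    have hi0 := hp0 i
    have hin := hpn i
    have hi := hp i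
    have : n i = 0 ∨ n i = 1 ∨ n i = 2 := by omega
    rcases this with h | h | h <;> rw [h] at hin hi
    · exact hcc.1 (hi0.symm.trans hin)
    · have := (hi 0 1 (by omega) le_rfl).2.mpr rfl
      rw [hi0, hin] at this
      exact hcc.2.1 this
    · have h1 := (hi 0 1 (by omega) (by omega)).2.mpr rfl
      have h2 := (hi 1 2 (by omega) le_rfl).2.mpr rfl
      rw [hi0] at h1
      rw [hin] at h2
      have h3 : p i 1 ∈ G.commonNeighbors c c' := ⟨h1, h2.symm⟩
      rw [hcc.2.2] at h3
      exact h3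
  have hodd : ∀ i j, i < j → ¬ Even (n i + n j) := by
    intro i j hij he
    have h1 := hn i
    have h2 := hn j
    exact hG _ (by omega) he (cycleGraph_isIndContained_of_paths (hp i) (hp j)
      ((hp0 i).trans (hp0 j).symm) ((hpn i).trans (hpn j).symm) (by omega) (by omega)
      (fun k l hk hki hl hlj => hS i j hij _ (hpS i k hk hki) _ (hpS j l hl hlj)))
  have h01 := hodd 0 1 (by decide)
  have h02 := hodd 0 2 (by decide)
  have h12 := hodd 1 2 (by decide)
  rw [Nat.not_even_iff] at h01 h02 h12
  omega

theorem edist_le_two_of_adj_adj {u a b : V} (h1 : G.Adj u a) (h2 : G.Adj a b) :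
    G.edist u b ≤ 2 := by
  have := edist_le (Walk.cons h1 (Walk.cons h2 Walk.nil))
  exact_mod_cast this

theorem edist_le_two_of_adj {u a : V} (h : G.Adj u a) : G.edist u a ≤ 2 := by
  rw [edist_eq_one_iff_adj.mpr h]
  norm_num

theorem reachable_within_step {S : Set V} {a b c : V} (h : G.Adj a b) (ha : a ∈ S) (hb : b ∈ S)
    (hbc : (G.within S).Reachable b c) : (G.within S).Reachable a c :=
  (show (G.within S).Adj a b from ⟨ha, hb, h⟩).reachable.trans hbc

theorem forall_fin_three_lt {P : Fin 3 → Fin 3 → Prop} (h01 : P 0 1) (h02 : P 0 2)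
    (h12 : P 1 2) : ∀ i j, i < j → P i j := by
  intro i j hij
  fin_cases i <;> fin_cases j <;> first | assumption | exact absurd hij (by decide)

theorem IsSystem.anticomplete {S A X : Set V} {f g : V → V} (h : G.IsSystem S A X f g) {u : V}
    (hu : u ∈ A) : G.Anticomplete ({g u} ∪ X) A := by
  rintro a (rfl | ha) b hb
  · exact h.g_A u hu b hb
  · exact ⟨(h.A_X b hb a ha).1.symm, fun hab => (h.A_X b hb a ha).2 hab.symm⟩

section Tripod

variable {S₁ S₂ S₃ A₁ A₂ A₃ X₁ X₂ X₃ : Set V} {f₁ f₂ f₃ g₁ g₂ g₃ : V → V}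

/-- The centre is `f₁ u`: one link goes through `g₁ u`, one along the given edge, and one back
through `u` down the third system. Interference is excluded because each later link lies in the set
`A` of the earlier system; edges at the centre itself are harmless. -/
theorem isTripod_of_edge (h₁ : G.IsSystem S₁ A₁ X₁ f₁ g₁) (h₂ : G.IsSystem S₂ A₂ X₂ f₂ g₂)
    (h₃ : G.IsSystem S₃ A₃ X₃ f₃ g₃) (h12 : S₂ ⊆ A₁) (h23 : S₃ ⊆ A₂) {u : V} (hu : u ∈ A₃)
    (he : ∃ x ∈ {g₂ u} ∪ X₂, G.Adj (f₁ u) x) : G.IsTripod ![X₁, X₂, X₃] u := by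
  have hu2 : u ∈ A₂ := h23 (h₃.A_sub hu)
  have hu1 : u ∈ A₁ := h12 (h₂.A_sub hu2)
  have a1 := h₁.anticomplete hu1
  have a2 := h₂.anticomplete hu2
  have s2 : {g₂ u} ∪ X₂ ⊆ A₁ := by
    rintro a (rfl | ha)
    exacts [h12 (h₂.g_mem u hu2), h12 (h₂.X_sub ha)]
  have s3 : {u, f₃ u, g₃ u} ∪ X₃ ⊆ A₂ := by
    rintro a ((rfl | rfl | rfl) | ha)
    exacts [hu2, h23 (h₃.f_mem _ hu), h23 (h₃.g_mem _ hu), h23 (h₃.X_sub ha)]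
  have s3' := s3.trans (h₂.A_sub.trans h12)
  refine ⟨f₁ u, ![{g₁ u}, {g₂ u}, {u, f₃ u, g₃ u}], edist_le_two_of_adj (h₁.adj_f u hu1), ?_,
    forall_fin_three_lt (a1.mono s2) (a1.mono s3') (a2.mono s3), ?_⟩
  · rw [Fin.forall_fin_succ, Fin.forall_fin_two]
    refine ⟨?_, ?_, ?_⟩
    · rintro b rfl
      exact edist_le_two_of_adj_adj (h₁.adj_f u hu1) (h₁.adj_g u hu1)
    · rintro b rfl
      exact edist_le_two_of_adj_adj (h₂.adj_f u hu2) (h₂.adj_g u hu2)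
    · rintro b (rfl | rfl | rfl)
      · simp
      · exact edist_le_two_of_adj (h₃.adj_f _ hu)
      · exact edist_le_two_of_adj_adj (h₃.adj_f u hu) (h₃.adj_g u hu)
  · rw [Fin.forall_fin_succ, Fin.forall_fin_two]
    refine ⟨?_, ?_, ?_⟩
    · obtain ⟨x, hx, hgx⟩ := h₁.adj_X u hu1
      exact ⟨x, hx, reachable_within_step (h₁.adj_g u hu1) (by simp) (by simp)
        (reachable_within_step hgx (by simp) (Or.inr (Or.inr hx)) .rfl)⟩
    · obtain ⟨x, hx, hgx⟩ := h₂.adj_X u hu2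
      obtain ⟨y, rfl | hy, hfy⟩ := he
      · exact ⟨x, hx, reachable_within_step hfy (by simp) (by simp)
          (reachable_within_step hgx (by simp) (Or.inr (Or.inr hx)) .rfl)⟩
      · exact ⟨y, hy, reachable_within_step hfy (by simp) (Or.inr (Or.inr hy)) .rfl⟩
    · obtain ⟨x, hx, hgx⟩ := h₃.adj_X u hu
      exact ⟨x, hx, reachable_within_step (h₁.adj_f u hu1).symm (by simp) (by simp)
        (reachable_within_step (h₃.adj_f u hu) (by simp) (by simp)
        (reachable_within_step (h₃.adj_g u hu) (by simp) (by simp)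
        (reachable_within_step hgx (by simp) (Or.inr (Or.inr hx)) .rfl)))⟩

/-- Only `f₁ u` can see into the second link; `he` excludes all of that link but `f₂ u`, and an edge
to `f₂ u` would form a triangle with `u`. -/
theorem IsSystem.anticomplete_of_no_edge (h3 : G.CliqueFree 3)
    (h₁ : G.IsSystem S₁ A₁ X₁ f₁ g₁) (h₂ : G.IsSystem S₂ A₂ X₂ f₂ g₂) (h12 : S₂ ⊆ A₁) {u : V}
    (hu : u ∈ A₂) (he : ¬ ∃ x ∈ {g₂ u} ∪ X₂, G.Adj (f₁ u) x) :
    G.Anticomplete ({f₁ u, g₁ u} ∪ X₁) ({f₂ u, g₂ u} ∪ X₂) := by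
  have hu1 : u ∈ A₁ := h12 (h₂.A_sub hu)
  have s2 : {f₂ u, g₂ u} ∪ X₂ ⊆ A₁ := by
    rintro a ((rfl | rfl) | ha)
    exacts [h12 (h₂.f_mem _ hu), h12 (h₂.g_mem _ hu), h12 (h₂.X_sub ha)]
  have hf : ∀ b ∈ {f₂ u, g₂ u} ∪ X₂, ¬ G.Adj (f₁ u) b := by
    rintro b ((rfl | hb) | hb) hadj
    · exact h3.not_adj_of_common (h₁.adj_f u hu1) hadj (h₂.adj_f u hu)
    · exact he ⟨b, Or.inl hb, hadj⟩
    · exact he ⟨b, Or.inr hb, hadj⟩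
  rintro a ((rfl | ha) | ha) b hb
  · refine ⟨?_, hf b hb⟩
    rintro rfl
    exact h₁.f_A u hu1 (s2 hb)
  · exact h₁.anticomplete hu1 a (Or.inl ha) b (s2 hb)
  · exact h₁.anticomplete hu1 a (Or.inr ha) b (s2 hb)

theorem IsSystem.link {S A X : Set V} {f g : V → V} (h : G.IsSystem S A X f g) {u : V}
    (hu : u ∈ A) : ∃ x ∈ X, (G.within (insert u ({f u, g u} ∪ X))).Reachable u x := by
  obtain ⟨x, hx, hgx⟩ := h.adj_X u hu
  exact ⟨x, hx, reachable_within_step (h.adj_f u hu) (by simp) (by simp)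
    (reachable_within_step (h.adj_g u hu) (by simp) (by simp)
    (reachable_within_step hgx (by simp) (Or.inr (Or.inr hx)) .rfl))⟩

theorem IsSystem.near {S A X : Set V} {f g : V → V} (h : G.IsSystem S A X f g) {u : V}
    (hu : u ∈ A) : ∀ b ∈ ({f u, g u} : Set V), G.edist u b ≤ 2 := by
  rintro b (rfl | rfl)
  · exact edist_le_two_of_adj (h.adj_f u hu)
  · exact edist_le_two_of_adj_adj (h.adj_f u hu) (h.adj_g u hu)

theorem isTripod_of_no_edge (h3 : G.CliqueFree 3) (h₁ : G.IsSystem S₁ A₁ X₁ f₁ g₁)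
    (h₂ : G.IsSystem S₂ A₂ X₂ f₂ g₂) (h₃ : G.IsSystem S₃ A₃ X₃ f₃ g₃) (h12 : S₂ ⊆ A₁)
    (h23 : S₃ ⊆ A₂) {u : V} (hu : u ∈ A₃)
    (he12 : ¬ ∃ x ∈ {g₂ u} ∪ X₂, G.Adj (f₁ u) x) (he13 : ¬ ∃ x ∈ {g₃ u} ∪ X₃, G.Adj (f₁ u) x)
    (he23 : ¬ ∃ x ∈ {g₃ u} ∪ X₃, G.Adj (f₂ u) x) : G.IsTripod ![X₁, X₂, X₃] u := by
  have hu2 : u ∈ A₂ := h23 (h₃.A_sub hu)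
  have hu1 : u ∈ A₁ := h12 (h₂.A_sub hu2)
  refine ⟨u, ![{f₁ u, g₁ u}, {f₂ u, g₂ u}, {f₃ u, g₃ u}], by simp, ?_, forall_fin_three_lt
    (h₁.anticomplete_of_no_edge h3 h₂ h12 hu2 he12)
    (h₁.anticomplete_of_no_edge h3 h₃ (h23.trans (h₂.A_sub.trans h12)) hu he13)
    (h₂.anticomplete_of_no_edge h3 h₃ h23 hu he23), ?_⟩
  · rw [Fin.forall_fin_succ, Fin.forall_fin_two]
    exact ⟨h₁.near hu1, h₂.near hu2, h₃.near hu⟩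
  · rw [Fin.forall_fin_succ, Fin.forall_fin_two]
    exact ⟨h₁.link hu1, h₂.link hu2, h₃.link hu⟩

end Tripod

/-! ### Counting colours -/

/-- Three classes of tripods take `3 * 64 = 192` colours, and each of the four nested systems costs
a factor 2: `3072 = 16 * 192`. -/
theorem colorable_of_noLongEvenHole (h3 : G.CliqueFree 3) (hG : G.NoLongEvenHole) :
    G.Colorable 3072 := by
  have ball : ∀ (v : V) (n : ℕ), 64 ≤ n →
      (G.within {u | G.edist v u ≤ (6 : ℕ)}).Colorable n := fun v n hn =>
    (edist_le_colorable h3 hG v 6).mono (by omega)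
  have ball' : ∀ (n : ℕ), 64 ≤ n → ∀ v : V,
      (G.within {u | G.edist v u ≤ (2 : ℕ)}).Colorable n := fun n hn v =>
    (edist_le_colorable h3 hG v 2).mono (by omega)
  by_contra hcol
  have hcol0 : ¬ (G.within Set.univ).Colorable (2 * 1536) := fun h =>
    hcol (h.mono_left (show G ≤ G.within Set.univ from fun _ _ hab => ⟨trivial, trivial, hab⟩))
  obtain ⟨A₁, X₁, f₁, g₁, h₁, hcol1⟩ := exists_isSystem hcol0 (ball' _ (by norm_num))
  obtain ⟨A₂, X₂, f₂, g₂, h₂, hcol2⟩ := exists_isSystem (n := 768) hcol1 (ball' _ (by norm_num))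
  obtain ⟨A₃, X₃, f₃, g₃, h₃, hcol3⟩ := exists_isSystem (n := 384) hcol2 (ball' _ (by norm_num))
  obtain ⟨A₄, X₄, f₄, g₄, h₄, hcol4⟩ := exists_isSystem (n := 192) hcol3 (ball' _ (by norm_num))
  have hclass : ∀ X : Fin 3 → Set V,
      (∀ i, ∀ a ∈ X i, ∀ b ∈ X i, (G.within (X i)).Reachable a b) →
      (G.within {u | G.IsTripod X u}).Colorable 64 := by
    intro X hX
    rcases Set.eq_empty_or_nonempty {u | G.IsTripod X u} with h | ⟨u, hu⟩
    · rw [h]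
      refine ⟨Coloring.mk (fun _ => 0) ?_⟩
      rintro u w ⟨hu, -⟩
      exact hu.elim
    · exact within_colorable_mono (fun t ht => IsTripod.edist_le hG hX hu ht)
        (ball u 64 le_rfl)
  have conn : ∀ {X Y Z : Set V}, (∀ a ∈ X, ∀ b ∈ X, (G.within X).Reachable a b) →
      (∀ a ∈ Y, ∀ b ∈ Y, (G.within Y).Reachable a b) →
      (∀ a ∈ Z, ∀ b ∈ Z, (G.within Z).Reachable a b) →
      ∀ i, ∀ a ∈ (![X, Y, Z] : Fin 3 → Set V) i, ∀ b ∈ (![X, Y, Z] : Fin 3 → Set V) i,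
        (G.within ((![X, Y, Z] : Fin 3 → Set V) i)).Reachable a b := by
    intro X Y Z hX hY hZ
    rw [Fin.forall_fin_succ, Fin.forall_fin_two]
    exact ⟨hX, hY, hZ⟩
  have c1 := hclass _ (conn h₁.conn h₂.conn h₃.conn)
  have c2 := hclass _ (conn h₁.conn h₃.conn h₄.conn)
  have c3 := hclass _ (conn h₂.conn h₃.conn h₄.conn)
  refine hcol4 (within_colorable_mono ?_ (within_union_colorable (within_union_colorable c1 c2) c3))
  intro u hu
  have hu3 : u ∈ A₃ := h₄.A_sub hu
  -- An edge from some `f` into a later link gives a tripod centred at that `f`; a fourth system is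
  -- needed when the edge involves the third one. With no such edge among the first three systems,
  -- `u` itself is the centre.
  by_cases he12 : ∃ x ∈ {g₂ u} ∪ X₂, G.Adj (f₁ u) x
  · exact Or.inl (Or.inl (isTripod_of_edge h₁ h₂ h₃ subset_rfl subset_rfl hu3 he12))
  by_cases he13 : ∃ x ∈ {g₃ u} ∪ X₃, G.Adj (f₁ u) x
  · exact Or.inl (Or.inr (isTripod_of_edge h₁ h₃ h₄ h₂.A_sub subset_rfl hu he13))
  by_cases he23 : ∃ x ∈ {g₃ u} ∪ X₃, G.Adj (f₂ u) x
  · exact Or.inr (isTripod_of_edge h₂ h₃ h₄ subset_rfl subset_rfl hu he23)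
  exact Or.inl (Or.inl
    (isTripod_of_no_edge h3 h₁ h₂ h₃ subset_rfl subset_rfl hu3 he12 he13 he23))

end SimpleGraph

theorem mainTheorem1 :
    ∃ c : ℕ, ∀ (V : Type*) (G : SimpleGraph V),
      G.CliqueFree 3 →
      (∀ n : ℕ, 6 ≤ n → Even n → ¬ (SimpleGraph.cycleGraph n).IsIndContained G) →
      G.chromaticNumber < (c : ℕ∞) := by
  refine ⟨3073, fun V G h3 hG => ?_⟩
  have h := (SimpleGraph.colorable_of_noLongEvenHole h3 hG).chromaticNumber_le
  exact lt_of_le_of_lt h (by norm_cast)
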